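/- A numerical semigroup is a subset $\Lambda \subseteq \mathbb{N}_0$ that contains $0$, is closed under addition and has finite complement. Its multiplicity is $m = \min(\Lambda\setminus\{0\})$, and its Frobenius number is the largest integer not in $\Lambda$. Its Apéry set consists of $m$ together with, for each $1 \le i \le m-1$, the least element of $\Lambda$ congruent to $i$ modulo $m$. We say that $\Lambda$ has maximal embedding dimension if its Apéry set is a minimal generating set of $\Lambda$ (it generates $\Lambda$ as an additive monoid, and no proper subset of it does). For each integer $f \ge 1$ let $\operatorname{MED}(f)$ be the number of numerical semigroups with maximal embedding dimension and Frobenius number $f$. Then $$\operatorname{MED}(f) = 2^{f/3 + o(f)} \qquad (f \to \infty);$$ that is, $\operatorname{MED}(f) = 2^{f/3+\varepsilon(f)}$ for all $f \ge 1$, where $\varepsilon(f)/f \to 0$ as $f \to \infty$. In particular, the limit $\lim_{f\to\infty} \frac{\log_2 \operatorname{MED}(f)}{f}$ exists and equals $\frac13$. -/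

import Mathlib

namespace NumSemigroup

/-- A numerical semigroup is an additive submonoid of `ℕ` (so it contains `0`) with finite
complement. -/
def IsNumericalSemigroup (Λ : AddSubmonoid ℕ) : Prop :=
  ((Λ : Set ℕ)ᶜ).Finite

/-- The multiplicity of `Λ`: its least nonzero element. -/
noncomputable def multiplicity (Λ : AddSubmonoid ℕ) : ℕ :=
  sInf {x : ℕ | x ∈ Λ ∧ x ≠ 0}

/-- The least element of `Λ` that is congruent to `i` modulo the multiplicity of `Λ`. -/
noncomputable def leastInClass (Λ : AddSubmonoid ℕ) (i : ℕ) : ℕ :=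
  sInf {x : ℕ | x ∈ Λ ∧ x ≡ i [MOD multiplicity Λ]}

/-- The Apéry set of `Λ`, where `m` is the multiplicity: `m` itself, together with, for each
`1 ≤ i ≤ m - 1`, the least element of `Λ` congruent to `i` modulo `m`. (In the residue class
of `0` the element is `m`, not `0`.) -/
noncomputable def aperySet (Λ : AddSubmonoid ℕ) : Set ℕ :=
  insert (multiplicity Λ) (leastInClass Λ '' Set.Ico 1 (multiplicity Λ))

/-- `Λ` has maximal embedding dimension: its Apéry set generates `Λ`, and no proper subset of
the Apéry set does. -/
def HasMaxEmbDim (Λ : AddSubmonoid ℕ) : Prop :=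
  Minimal (fun S : Set ℕ => AddSubmonoid.closure S = Λ) (aperySet Λ)

/-- The set of numerical semigroups with maximal embedding dimension and Frobenius number `f`
(the largest natural number not in `Λ`). -/
def medSemigroups (f : ℕ) : Set (AddSubmonoid ℕ) :=
  {Λ | IsNumericalSemigroup Λ ∧ HasMaxEmbDim Λ ∧ FrobeniusNumber f (Λ : Set ℕ)}

/-- There are only finitely many of them, so that `Set.ncard` below is a true count. -/
theorem medSemigroups_finite (f : ℕ) : (medSemigroups f).Finite := by
  refine Set.Finite.of_finite_image (f := fun Λ : AddSubmonoid ℕ => (Λ : Set ℕ) ∩ Set.Iic f)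
    ((Set.finite_Iic f).finite_subsets.subset ?_) ?_
  · rintro _ ⟨Λ, _, rfl⟩
    exact Set.inter_subset_right
  · rintro Λ ⟨_, _, h⟩ Λ' ⟨_, _, h'⟩ heq
    rw [frobeniusNumber_iff, AddSubmonoid.closure_eq] at h h'
    ext x
    by_cases hx : x ≤ f
    · have := Set.ext_iff.mp heq x
      simpa [hx] using this
    · exact iff_of_true (h.2 x (by omega)) (h'.2 x (by omega))

/-- The number of numerical semigroups with maximal embedding dimension and Frobenius
number `f`. -/
noncomputable def MED (f : ℕ) : ℕ :=
  (medSemigroups f).ncard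

end NumSemigroup

/-! Maximal embedding dimension amounts to `x + y - m ∈ Λ` for all nonzero `x, y ∈ Λ`, where `m` is
the multiplicity. Hence `(Λ \ {0}) - m` is a numerical semigroup that contains `m` and has all gaps
at most `g = f - m`. The upper bound counts such gap sets `G` for each `m`.

Let `T` consist of the `q²` largest gaps. Below `T`, the non-gaps form an independent set in the
graph joining `x` and `y` when `x + y ∈ T`. A container argument places them in a set `U`,
determined by `T` and a fingerprint of at most `(g + 1) / q` elements, with `|U|` at most about `g /
2` (`exists_fingerprint`, `card_container_le`). As `m` is a non-gap, the non-gaps are upward closed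
in each class modulo `m`, so `G` is determined by `T` and their number in each class. This leaves at
most `∏ (|U_i| + 1)` choices (`card_fiber_le`). Since `(a + 1)³ ≤ 2^(2a + 1)`, the cube of the
product is at most `2^(2|U| + m)`, roughly `2^(g + m) = 2^f`. The choices of `m`, `T` and the
fingerprint cost `2^(o(f))` as `f → ∞` and then `q → ∞`.

For the lower bound, take `m` just above `f / 3` and choose the elements between `2m` and `f`
freely. -/

/-! ### Elementary estimates -/

open Finset in
theorem card_filter_card_le_le (s : Finset ℕ) (k q : ℕ) (hq : 1 ≤ q) :
    ((s.powerset.filter (fun F => F.card ≤ k)).card : ℝ) ≤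
      (q : ℝ) ^ k * (1 + 1 / (q : ℝ)) ^ s.card := by
  have hq0 : (0 : ℝ) < q := by exact_mod_cast hq
  have hx1 : (1 / (q : ℝ)) ≤ 1 := by
    rw [div_le_one hq0]; exact_mod_cast hq
  -- Binomial theorem. Multiplied by `q ^ k`, every term with `F.card ≤ k` is at least 1.
  have hsum : (∑ F ∈ s.powerset, (1 / (q : ℝ)) ^ F.card) = (1 + 1 / (q : ℝ)) ^ s.card := by
    have := Finset.sum_pow_mul_eq_add_pow (1 / (q : ℝ)) 1 s
    simpa [add_comm] using this
  rw [← hsum, Finset.mul_sum, Finset.card_eq_sum_ones, Nat.cast_sum]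
  calc ∑ F ∈ s.powerset.filter (fun F => F.card ≤ k), ((1 : ℕ) : ℝ)
      ≤ ∑ F ∈ s.powerset.filter (fun F => F.card ≤ k), (q : ℝ) ^ k * (1 / (q : ℝ)) ^ F.card := by
        refine Finset.sum_le_sum fun F hF => ?_
        have hF := (Finset.mem_filter.1 hF).2
        calc ((1 : ℕ) : ℝ) = (q : ℝ) ^ k * (1 / (q : ℝ)) ^ k := by
              rw [← mul_pow, mul_one_div_cancel hq0.ne']; simp
          _ ≤ _ := by
              gcongr ?_ * ?_
              exact pow_le_pow_of_le_one (by positivity) hx1 hF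
    _ ≤ _ := Finset.sum_le_sum_of_subset_of_nonneg (Finset.filter_subset _ _)
        (fun _ _ _ => by positivity)

/-- This is the source of the 1/3: it bounds the factor of one residue class containing `a` elements
of the container. Equality holds at `a = 1`. -/
theorem two_mul_succ_pow_three_le (a : ℕ) : 2 * (a + 1) ^ 3 ≤ 4 ^ (a + 1) := by
  induction a with
  | zero => norm_num
  | succ a ih =>
    rcases a with _ | a
    · norm_num
    · rw [pow_succ 4]
      nlinarith [sq_nonneg (a : ℤ), Nat.zero_le (a ^ 3), Nat.zero_le (a ^ 2)]

open Finset in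
theorem exists_top_subset (G : Finset ℕ) (d : ℕ) (hd : d ≤ G.card) :
    ∃ T ⊆ G, T.card = d ∧ ∀ x ∈ G, x ∉ T → ∀ t ∈ T, x ≤ t := by
  induction d with
  | zero => exact ⟨∅, by simp⟩
  | succ d ih =>
    obtain ⟨T, hT, hc, h⟩ := ih (by omega)
    have hne : (G \ T).Nonempty := by
      rw [← Finset.card_pos, Finset.card_sdiff_of_subset hT]; omega
    have hmem := Finset.max'_mem _ hne
    rw [mem_sdiff] at hmem
    refine ⟨insert ((G \ T).max' hne) T, ?_, ?_, ?_⟩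
    · exact Finset.insert_subset hmem.1 hT
    · rw [Finset.card_insert_of_notMem hmem.2, hc]
    · intro x hx hxT t ht
      rw [mem_insert, not_or] at hxT
      rcases mem_insert.1 ht with rfl | ht
      · exact Finset.le_max' _ _ (mem_sdiff.2 ⟨hx, hxT.2⟩)
      · exact h x hx hxT.2 t ht

/-! ### Containers for gap sets -/

namespace GapSets

open Finset

/-- The gap sets, all of whose elements are at most `g`, of the numerical semigroups that
contain `m`. -/
def family (m g : ℕ) : Set (Finset ℕ) :=
  {G | G ⊆ range (g + 1) ∧ m ∉ G ∧ ∀ x, x ∉ G → ∀ y, y ∉ G → x + y ∉ G}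

/-- The numbers up to `g` that are at most every element of `T`. -/
def below (g : ℕ) (T : Finset ℕ) : Finset ℕ := (range (g + 1)).filter (fun x => ∀ t ∈ T, x ≤ t)

/-- The numbers in `below g T` whose sum with `x` lies in `T`. -/
def nbrs (g : ℕ) (T : Finset ℕ) (x : ℕ) : Finset ℕ := (below g T).filter (fun y => x + y ∈ T)

/-- The container determined by the fingerprint `F`. -/
def container (g : ℕ) (T : Finset ℕ) (q : ℕ) (F : Finset ℕ) : Finset ℕ :=
  (below g T \ F.biUnion (nbrs g T)).filter
    (fun x => (nbrs g T x \ F.biUnion (nbrs g T)).card < q)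

/-- Take `F` largest among the sets of non-gaps with at least `q * F.card` neighbours. A non-gap
with `q` or more neighbours outside those of `F` could be added to `F`. No non-gap is itself a
neighbour of `F`, since that would make a sum of two non-gaps a gap. -/
theorem exists_fingerprint {m g q : ℕ} {G T : Finset ℕ} (hG : G ∈ family m g) (hTG : T ⊆ G)
    (hq : 1 ≤ q) :
    ∃ F ⊆ range (g + 1), F.card * q ≤ g + 1 ∧ below g T \ G ⊆ container g T q F := by
  classical
  obtain ⟨-, -, hadd⟩ := hG
  let good := ((below g T \ G).powerset).filter
    (fun F => F.card * q ≤ (F.biUnion (nbrs g T)).card)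
  have hne : good.Nonempty := ⟨∅, by simp [good]⟩
  obtain ⟨F, hF, hmax⟩ := Finset.exists_max_image good Finset.card hne
  simp only [good, mem_filter, mem_powerset] at hF hmax
  have hFr : ∀ x ∈ F, x ∉ G := fun x hx => (mem_sdiff.1 (hF.1 hx)).2
  refine ⟨F, ?_, ?_, ?_⟩
  · exact hF.1.trans (sdiff_subset.trans (filter_subset _ _))
  · refine hF.2.trans ?_
    calc _ ≤ (range (g + 1)).card := card_le_card (by
          rw [biUnion_subset]
          intro x _
          exact (filter_subset _ _).trans (filter_subset _ _))
      _ = g + 1 := card_range _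
  · intro s hs
    have hs' := mem_sdiff.1 hs
    have hsN : s ∉ F.biUnion (nbrs g T) := by
      rw [mem_biUnion]
      rintro ⟨x, hx, hsx⟩
      exact hadd x (hFr x hx) s hs'.2 (hTG (mem_filter.1 hsx).2)
    refine mem_filter.2 ⟨mem_sdiff.2 ⟨hs'.1, hsN⟩, ?_⟩
    by_contra! hcard
    have hsF : s ∉ F := by
      intro hsF
      have : nbrs g T s \ F.biUnion (nbrs g T) = ∅ :=
        sdiff_eq_empty_iff_subset.2 (subset_biUnion_of_mem (nbrs g T) hsF)
      rw [this, card_empty] at hcard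
      omega
    have := hmax (insert s F) ⟨insert_subset hs hF.1, by
      rw [card_insert_of_notMem hsF, biUnion_insert, ← sdiff_union_self_eq_union,
        card_union_of_disjoint sdiff_disjoint]
      have := hF.2
      nlinarith⟩
    rw [card_insert_of_notMem hsF] at this
    omega

/-- Each `x ∈ U` has fewer than `q` neighbours in `U`, so averaging over the `q²` elements of `T`
gives a `t` with at most `(g + 1) / q` elements `x ∈ U` such that `t - x ∈ U`. Thus `U` and its
reflection `t - U` have equal size, lie in `[0, g]` and are almost disjoint. -/
theorem card_container_le {g q : ℕ} {T F : Finset ℕ} (hT : T ⊆ range (g + 1))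
    (hcard : T.card = q * q) (hq : 1 ≤ q) :
    2 * (container g T q F).card ≤ g + 1 + (g + 1) / q := by
  classical
  set U := container g T q F with hU
  have hUr : U ⊆ range (g + 1) :=
    (filter_subset _ _).trans (sdiff_subset.trans (filter_subset _ _))
  have hUc : U.card ≤ g + 1 := by simpa using card_le_card hUr
  have hUle : ∀ x ∈ U, ∀ t ∈ T, x ≤ t := fun x hx =>
    (mem_filter.1 (mem_sdiff.1 (mem_filter.1 hx).1).1).2
  have hdouble : ∑ t ∈ T, (U.filter (fun x => t - x ∈ U)).card ≤ U.card * q := by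
    calc ∑ t ∈ T, (U.filter (fun x => t - x ∈ U)).card
        = ∑ x ∈ U, (T.filter (fun t => t - x ∈ U)).card :=
          Finset.sum_card_bipartiteAbove_eq_sum_card_bipartiteBelow _
      _ ≤ ∑ x ∈ U, q := by
          refine sum_le_sum fun x hx => ?_
          have hx' := (mem_filter.1 hx).2
          refine le_trans ?_ hx'.le
          refine card_le_card_of_injOn (fun t => t - x) ?_ ?_
          · intro t ht
            have ht := mem_filter.1 (mem_coe.1 ht)
            have hu := mem_sdiff.1 (mem_filter.1 ht.2).1
            refine mem_coe.2 (mem_sdiff.2 ⟨mem_filter.2 ⟨hu.1, ?_⟩, hu.2⟩)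
            rw [Nat.add_sub_cancel' (hUle x hx t ht.1)]
            exact ht.1
          · intro t ht t' ht' h
            have h1 := hUle x hx t (mem_filter.1 (mem_coe.1 ht)).1
            have h2 := hUle x hx t' (mem_filter.1 (mem_coe.1 ht')).1
            simp only at h
            omega
      _ = U.card * q := by simp
  have hTne : T.Nonempty := by rw [← card_pos, hcard]; positivity
  obtain ⟨t, ht, hmin⟩ := exists_min_image T
    (fun t => (U.filter (fun x => t - x ∈ U)).card) hTne
  have h1 : q * q * (U.filter (fun x => t - x ∈ U)).card ≤ U.card * q := by
    refine le_trans ?_ hdouble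
    rw [← hcard, ← smul_eq_mul]
    exact card_nsmul_le_sum _ _ _ hmin
  have h2 : (U.filter (fun x => t - x ∈ U)).card ≤ (g + 1) / q := by
    rw [Nat.le_div_iff_mul_le (by omega)]
    nlinarith
  have htg : t < g + 1 := mem_range.1 (hT ht)
  have hinj : Set.InjOn (fun x => t - x) (U : Set ℕ) := by
    intro x hx y hy h
    have h1 := hUle x hx t ht
    have h2 := hUle y hy t ht
    simp only at h
    omega
  have h3 : (U ∪ U.image (fun x => t - x)).card ≤ g + 1 := by
    rw [← card_range (g + 1)]
    refine card_le_card (union_subset hUr ?_)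
    intro y hy
    obtain ⟨x, -, rfl⟩ := mem_image.1 hy
    rw [mem_range]; omega
  have h4 : (U ∩ U.image (fun x => t - x)).card ≤ (U.filter (fun x => t - x ∈ U)).card := by
    refine card_le_card ?_
    intro y hy
    obtain ⟨hy, hy'⟩ := mem_inter.1 hy
    obtain ⟨x, hx, rfl⟩ := mem_image.1 hy'
    refine mem_filter.2 ⟨hy, ?_⟩
    have := hUle x hx t ht
    rwa [Nat.sub_sub_self this]
  have h5 := card_union_add_card_inter U (U.image (fun x => t - x))
  rw [card_image_of_injOn hinj] at h5
  omega

/-! ### Counting by residue classes modulo the multiplicity -/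

/-- The residue class of `i` modulo `m` inside `U`. -/
def residue (m : ℕ) (U : Finset ℕ) (i : ℕ) : Finset ℕ := U.filter (fun x => x % m = i)

theorem prod_card_residue_pow_three_le (m : ℕ) (hm : 0 < m) (U : Finset ℕ) :
    (∏ i : Fin m, ((residue m U i).card + 1)) ^ 3 ≤ 2 ^ (2 * U.card + m) := by
  have hsum : ∑ i : Fin m, (residue m U i).card = U.card := by
    rw [Fin.sum_univ_eq_sum_range (fun i => (residue m U i).card)]
    exact (card_eq_sum_card_fiberwise (f := fun x => x % m) (t := range m)
      (fun x _ => by simpa using Nat.mod_lt x hm)).symm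
  -- The factor `2 ^ m` supplies one 2 to each class, as `two_mul_succ_pow_three_le` requires.
  have h : 2 ^ m * (∏ i : Fin m, ((residue m U i).card + 1)) ^ 3 ≤ 2 ^ m * 2 ^ (2 * U.card + m) := by
    calc 2 ^ m * (∏ i : Fin m, ((residue m U i).card + 1)) ^ 3
        = ∏ i : Fin m, (2 * ((residue m U i).card + 1) ^ 3) := by
          rw [prod_mul_distrib, prod_pow]; simp
      _ ≤ ∏ i : Fin m, 4 ^ ((residue m U i).card + 1) :=
          prod_le_prod' fun i _ => two_mul_succ_pow_three_le _
      _ = 4 ^ (U.card + m) := by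
          rw [prod_pow_eq_pow_sum, sum_add_distrib, hsum]; simp
      _ = 2 ^ m * 2 ^ (2 * U.card + m) := by
          rw [show (4 : ℕ) = 2 ^ 2 by norm_num, ← pow_mul, ← pow_add]; congr 1; ring
  exact Nat.le_of_mul_le_mul_left h (by positivity)

theorem add_mul_notMem {m g : ℕ} {G : Finset ℕ} (hG : G ∈ family m g) {x : ℕ} (hx : x ∉ G)
    (k : ℕ) : x + k * m ∉ G := by
  induction k with
  | zero => simpa using hx
  | succ k ih =>
    rw [add_mul, one_mul, ← add_assoc]
    exact hG.2.2 _ ih _ hG.2.1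

theorem notMem_of_le_of_mod_eq {m g : ℕ} {G : Finset ℕ} (hG : G ∈ family m g) {x y : ℕ}
    (hx : x ∉ G) (hxy : x ≤ y) (h : x % m = y % m) : y ∉ G := by
  obtain ⟨k, hk⟩ := (Nat.modEq_iff_dvd' hxy).1 h
  have : y = x + k * m := by rw [mul_comm, ← hk]; omega
  rw [this]
  exact add_mul_notMem hG hx k

/-- Within a residue class, the non-gaps of `G` and of `G'` are upward closed, hence nested, so
equal cardinalities force them to agree. -/
theorem mem_of_card_residue_eq {m g : ℕ} {L G G' : Finset ℕ} (hG : G ∈ family m g)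
    (hG' : G' ∈ family m g) {x : ℕ} (hxL : x ∈ L)
    (h : (residue m (L \ G) (x % m)).card = (residue m (L \ G') (x % m)).card)
    (hx : x ∈ G') : x ∈ G := by
  by_contra hxG
  refine (card_lt_card (s := residue m (L \ G') (x % m)) (t := residue m (L \ G) (x % m)) ?_).ne'
    h
  rw [ssubset_iff_of_subset]
  · exact ⟨x, mem_filter.2 ⟨mem_sdiff.2 ⟨hxL, hxG⟩, rfl⟩, fun hx' =>
      (mem_sdiff.1 (mem_filter.1 hx').1).2 hx⟩
  · intro y hy
    obtain ⟨hy, hyx⟩ := mem_filter.1 hy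
    obtain ⟨hyL, hyG'⟩ := mem_sdiff.1 hy
    refine mem_filter.2 ⟨mem_sdiff.2 ⟨hyL, ?_⟩, hyx⟩
    rcases le_total y x with hle | hle
    · exact absurd hx (notMem_of_le_of_mod_eq hG' hyG' hle hyx)
    · exact notMem_of_le_of_mod_eq hG hxG hle hyx.symm

open Classical in
/-- The members of `family m g` that have `T` as top part and whose non-gaps below `T` lie
in `U`. -/
noncomputable def fiber (m g : ℕ) (T U : Finset ℕ) : Finset (Finset ℕ) :=
  (range (g + 1)).powerset.filter
    (fun G => G ∈ family m g ∧ T ⊆ G ∧ G \ T ⊆ below g T ∧ below g T \ G ⊆ U)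

theorem card_fiber_le (m g : ℕ) (hm : 0 < m) (T U : Finset ℕ) :
    (fiber m g T U).card ≤ ∏ i : Fin m, ((residue m U i).card + 1) := by
  classical
  have hcard : (Fintype.piFinset fun i : Fin m => range ((residue m U i).card + 1)).card =
      ∏ i : Fin m, ((residue m U i).card + 1) := by simp
  rw [← hcard]
  refine card_le_card_of_injOn
    (fun G => fun i : Fin m => (residue m (below g T \ G) i).card) ?_ ?_
  · intro G hG
    have hG := (mem_filter.1 (mem_coe.1 hG)).2
    refine mem_coe.2 (Fintype.mem_piFinset.2 fun i => mem_range.2 (Nat.lt_succ_of_le ?_))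
    exact card_le_card (filter_subset_filter _ hG.2.2.2)
  · have key : ∀ G ∈ fiber m g T U, ∀ G' ∈ fiber m g T U,
        (fun i : Fin m => (residue m (below g T \ G) i).card) =
          (fun i : Fin m => (residue m (below g T \ G') i).card) → G' ⊆ G := by
      intro G hG G' hG' h x hx
      have hG := (mem_filter.1 hG).2
      have hG' := (mem_filter.1 hG').2
      by_cases hxT : x ∈ T
      · exact hG.2.1 hxT
      · exact mem_of_card_residue_eq hG.1 hG'.1 (hG'.2.2.1 (mem_sdiff.2 ⟨hx, hxT⟩))
          (congrFun h ⟨x % m, Nat.mod_lt _ hm⟩) hx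
    intro G hG G' hG' h
    exact (key G' hG' G hG h.symm).antisymm (key G hG G' hG' h)

/-- The subsets of `range n` with at most `k` elements. -/
def smallSubsets (n k : ℕ) : Finset (Finset ℕ) :=
  (range n).powerset.filter (fun F => F.card ≤ k)

theorem ncard_family_le (m g q n P : ℕ) (hm : 0 < m) (hq : 1 ≤ q) (hn : m + g ≤ n)
    (hP : ∀ a : ℕ, a ^ 3 ≤ 2 ^ (n + 1 + n / q) → a ≤ P) :
    (family m g).ncard ≤
      (smallSubsets n (q * q)).card * (1 + (smallSubsets n (n / q)).card * P) := by
  classical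
  have hgn : range (g + 1) ⊆ range n := range_subset_range.2 (by omega)
  have hsub : family m g ⊆ ((smallSubsets n (q * q) ∪
      ((smallSubsets n (q * q)).filter (fun T => T ⊆ range (g + 1) ∧ T.card = q * q)).biUnion
        (fun T => (smallSubsets n (n / q)).biUnion
        (fun F => fiber m g T (container g T q F))) : Finset (Finset ℕ)) : Set (Finset ℕ)) := by
    intro G hG
    rw [mem_coe, mem_union]
    -- Gap sets with at most `q²` elements are counted directly; the others have a top part `T`.
    rcases le_total G.card (q * q) with hle | hle
    · exact Or.inl (mem_filter.2 ⟨mem_powerset.2 (hG.1.trans hgn), hle⟩)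
    · right
      obtain ⟨T, hTG, hTc, hT⟩ := exists_top_subset G (q * q) hle
      obtain ⟨F, hF, hFc, hc⟩ := exists_fingerprint hG hTG hq
      have hTr : T ⊆ range (g + 1) := hTG.trans hG.1
      refine mem_biUnion.2 ⟨T, mem_filter.2 ⟨mem_filter.2 ⟨mem_powerset.2 (hTr.trans hgn),
        hTc.le⟩, hTr, hTc⟩, mem_biUnion.2 ⟨F, mem_filter.2 ⟨mem_powerset.2 (hF.trans hgn), ?_⟩,
        mem_filter.2 ⟨mem_powerset.2 hG.1, hG, hTG, ?_, hc⟩⟩⟩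
      · rw [Nat.le_div_iff_mul_le (by omega)]; omega
      · intro x hx
        obtain ⟨hx, hxT⟩ := mem_sdiff.1 hx
        exact mem_filter.2 ⟨hG.1 hx, hT x hx hxT⟩
  have h1 := Set.ncard_le_ncard hsub (finite_toSet _)
  rw [Set.ncard_coe_finset] at h1
  refine h1.trans ((card_union_le _ _).trans ?_)
  rw [mul_add, mul_one]
  refine Nat.add_le_add_left ?_ _
  refine le_trans (card_biUnion_le_card_mul _ _ ((smallSubsets n (n / q)).card * P) ?_)
    (Nat.mul_le_mul_right _ (card_filter_le _ _))
  intro T hT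
  obtain ⟨-, hTr, hTc⟩ := mem_filter.1 hT
  refine card_biUnion_le_card_mul _ _ _ fun F _ => ?_
  refine (card_fiber_le m g hm T _).trans (hP _ ((prod_card_residue_pow_three_le m hm _).trans ?_))
  refine Nat.pow_le_pow_right (by norm_num) ?_
  have h2 := card_container_le (F := F) hTr hTc hq
  have h3 : (g + 1) / q ≤ n / q := Nat.div_le_div_right (by omega)
  omega

end GapSets

/-! ### Maximal embedding dimension and the reduction to gap sets -/

namespace NumSemigroup

theorem multiplicity_spec {Λ : AddSubmonoid ℕ} {f : ℕ} (hf : ∀ k > f, k ∈ Λ) :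
    multiplicity Λ ∈ Λ ∧ multiplicity Λ ≠ 0 :=
  Nat.sInf_mem (s := {x : ℕ | x ∈ Λ ∧ x ≠ 0}) ⟨f + 1, hf _ (by omega), by omega⟩

theorem multiplicity_le {Λ : AddSubmonoid ℕ} {x : ℕ} (hx : x ∈ Λ) (h0 : x ≠ 0) :
    multiplicity Λ ≤ x :=
  Nat.sInf_le (s := {x : ℕ | x ∈ Λ ∧ x ≠ 0}) ⟨hx, h0⟩

theorem leastInClass_spec {Λ : AddSubmonoid ℕ} {f : ℕ} (hf : ∀ k > f, k ∈ Λ) (i : ℕ) :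
    leastInClass Λ i ∈ Λ ∧ leastInClass Λ i ≡ i [MOD multiplicity Λ] := by
  refine Nat.sInf_mem (s := {x : ℕ | x ∈ Λ ∧ x ≡ i [MOD multiplicity Λ]})
    ⟨i + multiplicity Λ * (f + 1), hf _ ?_, by simp [Nat.ModEq]⟩
  have := (multiplicity_spec hf).2
  have : 1 * (f + 1) ≤ multiplicity Λ * (f + 1) := Nat.mul_le_mul_right _ (by omega)
  omega

theorem leastInClass_le {Λ : AddSubmonoid ℕ} {i x : ℕ} (hx : x ∈ Λ)
    (h : x ≡ i [MOD multiplicity Λ]) : leastInClass Λ i ≤ x :=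
  Nat.sInf_le (s := {x : ℕ | x ∈ Λ ∧ x ≡ i [MOD multiplicity Λ]}) ⟨hx, h⟩

theorem mem_of_modEq_of_le {Λ : AddSubmonoid ℕ} {m x y : ℕ} (hm : m ∈ Λ) (hx : x ∈ Λ)
    (hxy : x ≤ y) (h : x ≡ y [MOD m]) : y ∈ Λ := by
  obtain ⟨k, hk⟩ := (Nat.modEq_iff_dvd' hxy).1 h
  have : y = x + k • m := by rw [smul_eq_mul, mul_comm, ← hk]; omega
  rw [this]
  exact Λ.add_mem hx (Λ.nsmul_mem hm k)

/-- Otherwise `x + y` is least in its nonzero class, hence an Apéry element. But `x` and `y`, being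
smaller, are generated by the other Apéry elements, so `x + y` is redundant, against minimality. -/
theorem add_sub_multiplicity_mem {Λ : AddSubmonoid ℕ} {f : ℕ} (hf : ∀ k > f, k ∈ Λ)
    (hΛ : HasMaxEmbDim Λ) {x y : ℕ} (hx : x ∈ Λ) (hy : y ∈ Λ) (hx0 : x ≠ 0) (hy0 : y ≠ 0) :
    x + y - multiplicity Λ ∈ Λ := by
  obtain ⟨hm, hm0⟩ := multiplicity_spec hf
  have hmx := multiplicity_le hx hx0
  set m := multiplicity Λ with hmdef
  by_contra hn
  have hmod : x + y - m ≡ x + y [MOD m] := by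
    have : x + y = x + y - m + m := by omega
    conv_rhs => rw [this]
    simp [Nat.ModEq]
  have hi0 : (x + y) % m ≠ 0 := by
    intro h0
    exact hn (mem_of_modEq_of_le hm Λ.zero_mem (Nat.zero_le _)
      ((show 0 ≡ x + y [MOD m] by simp [Nat.ModEq, h0]).trans hmod.symm))
  have hleast : leastInClass Λ ((x + y) % m) = x + y := by
    obtain ⟨h1, h2⟩ := leastInClass_spec hf ((x + y) % m)
    have h2' : leastInClass Λ ((x + y) % m) ≡ x + y [MOD m] := h2.trans (Nat.mod_modEq _ _)
    have h3 := leastInClass_le (Λ.add_mem hx hy) (Nat.mod_modEq (x + y) m).symm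
    by_contra hne
    have hlt : leastInClass Λ ((x + y) % m) < x + y := by omega
    have h4 : m ≤ x + y - leastInClass Λ ((x + y) % m) :=
      Nat.le_of_dvd (by omega) ((Nat.modEq_iff_dvd' h3).1 h2')
    exact hn (mem_of_modEq_of_le hm h1 (by omega) (h2'.trans hmod.symm))
  have hA : x + y ∈ aperySet Λ :=
    Or.inr ⟨(x + y) % m, ⟨by omega, Nat.mod_lt _ (by omega)⟩, hleast⟩
  have hsmall : ∀ z ∈ AddSubmonoid.closure (aperySet Λ), z < x + y →
      z ∈ AddSubmonoid.closure (aperySet Λ \ {x + y}) := by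
    intro z hz
    induction hz using AddSubmonoid.closure_induction with
    | mem z hz =>
      intro hlt
      exact AddSubmonoid.subset_closure ⟨hz, by simpa using hlt.ne⟩
    | zero => exact fun _ => AddSubmonoid.zero_mem _
    | add a b _ _ iha ihb =>
      exact fun hlt => AddSubmonoid.add_mem _ (iha (by omega)) (ihb (by omega))
  have hcl : AddSubmonoid.closure (aperySet Λ) = Λ := hΛ.prop
  have hxy : x + y ∈ AddSubmonoid.closure (aperySet Λ \ {x + y}) :=
    AddSubmonoid.add_mem _ (hsmall x (by rwa [hcl]) (by omega)) (hsmall y (by rwa [hcl]) (by omega))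
  have hcl' : AddSubmonoid.closure (aperySet Λ \ {x + y}) = Λ := by
    refine le_antisymm ((AddSubmonoid.closure_mono Set.sdiff_subset).trans hcl.le) ?_
    conv_lhs => rw [← hcl]
    rw [AddSubmonoid.closure_le]
    intro z hz
    by_cases h : z = x + y
    · rw [h]; exact hxy
    · exact AddSubmonoid.subset_closure ⟨hz, h⟩
  exact (hΛ.le_of_le hcl' Set.sdiff_subset hA).2 rfl

theorem closure_aperySet {Λ : AddSubmonoid ℕ} {f : ℕ} (hf : ∀ k > f, k ∈ Λ) :
    AddSubmonoid.closure (aperySet Λ) = Λ := by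
  obtain ⟨hm, hm0⟩ := multiplicity_spec hf
  refine le_antisymm ((AddSubmonoid.closure_le).2 ?_) ?_
  · rintro x (rfl | ⟨i, -, rfl⟩)
    · exact hm
    · exact (leastInClass_spec hf i).1
  · intro x hx
    have hmA : multiplicity Λ ∈ AddSubmonoid.closure (aperySet Λ) :=
      AddSubmonoid.subset_closure (Or.inl rfl)
    by_cases h0 : x % multiplicity Λ = 0
    · exact mem_of_modEq_of_le hmA (AddSubmonoid.zero_mem _) (Nat.zero_le _)
        (by simp [Nat.ModEq, h0])
    · exact mem_of_modEq_of_le hmA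
        (AddSubmonoid.subset_closure
          (Or.inr ⟨x % multiplicity Λ, ⟨by omega, Nat.mod_lt _ (by omega)⟩, rfl⟩))
        (leastInClass_le hx (Nat.mod_modEq _ _).symm)
        ((leastInClass_spec hf _).2.trans (Nat.mod_modEq _ _))

/-- Under `h`, no Apéry element is a sum of two nonzero elements of `Λ`, so each one lies in every
generating set. -/
theorem hasMaxEmbDim_of_add_sub_mem {Λ : AddSubmonoid ℕ} {f : ℕ} (hf : ∀ k > f, k ∈ Λ)
    (h : ∀ x ∈ Λ, ∀ y ∈ Λ, x ≠ 0 → y ≠ 0 → x + y - multiplicity Λ ∈ Λ) : HasMaxEmbDim Λ := by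
  obtain ⟨hm, hm0⟩ := multiplicity_spec hf
  have hirr : ∀ z ∈ aperySet Λ, z ≠ 0 ∧ ∀ x ∈ Λ, ∀ y ∈ Λ, x ≠ 0 → y ≠ 0 → z ≠ x + y := by
    rintro z (rfl | ⟨i, ⟨hi, him⟩, rfl⟩)
    · refine ⟨hm0, fun x hx y _ hx0 hy0 => ?_⟩
      have := multiplicity_le hx hx0
      omega
    · obtain ⟨-, h2⟩ := leastInClass_spec hf i
      refine ⟨fun h0 => ?_, fun x hx y hy hx0 hy0 hxy => ?_⟩
      · rw [h0, Nat.ModEq, Nat.zero_mod, Nat.mod_eq_of_lt him] at h2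
        omega
      · have hmx := multiplicity_le hx hx0
        have hmod : x + y - multiplicity Λ ≡ i [MOD multiplicity Λ] := by
          refine Nat.ModEq.trans ?_ h2
          rw [hxy]
          have : x + y = x + y - multiplicity Λ + multiplicity Λ := by omega
          conv_rhs => rw [this]
          simp [Nat.ModEq]
        have := leastInClass_le (h x hx y hy hx0 hy0) hmod
        omega
  refine ⟨closure_aperySet hf, fun S hS _ z hz => ?_⟩
  have hS : AddSubmonoid.closure S = Λ := hS
  have key : ∀ z ∈ AddSubmonoid.closure S,
      z = 0 ∨ z ∈ S ∨ ∃ x ∈ Λ, ∃ y ∈ Λ, x ≠ 0 ∧ y ≠ 0 ∧ z = x + y := by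
    intro z hz
    induction hz using AddSubmonoid.closure_induction with
    | mem z hz => exact Or.inr (Or.inl hz)
    | zero => exact Or.inl rfl
    | add a b ha hb iha ihb =>
      by_cases ha0 : a = 0
      · simpa [ha0] using ihb
      by_cases hb0 : b = 0
      · simpa [hb0] using iha
      rw [hS] at ha hb
      exact Or.inr (Or.inr ⟨a, ha, b, hb, ha0, hb0, rfl⟩)
  obtain ⟨hz0, hzirr⟩ := hirr z hz
  have hzS : z ∈ AddSubmonoid.closure S := by
    rw [hS]
    rw [← closure_aperySet hf]
    exact AddSubmonoid.subset_closure hz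
  rcases key z hzS with h0 | hz | ⟨x, hx, y, hy, hx0, hy0, hxy⟩
  · exact absurd h0 hz0
  · exact hz
  · exact absurd hxy (hzirr x hx y hy hx0 hy0)

theorem frobeniusNumber_coe_iff {Λ : AddSubmonoid ℕ} {f : ℕ} :
    FrobeniusNumber f (Λ : Set ℕ) ↔ f ∉ Λ ∧ ∀ k > f, k ∈ Λ := by
  rw [frobeniusNumber_iff, AddSubmonoid.closure_eq]

open Finset in
-- For fixed `m`, send `Λ` to the gap set of `(Λ \ {0}) - m`; here `m` is a non-gap because `2m ∈
-- Λ`. The subtraction `f - m` truncates only at `m = f + 1`, where that gap set is empty.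
theorem MED_le (f K : ℕ)
    (hK : ∀ m, 1 ≤ m → m ≤ f + 1 → (GapSets.family m (f - m)).ncard ≤ K) :
    MED f ≤ K * (f + 1) := by
  classical
  rw [MED, Set.ncard_eq_toFinset_card _ (medSemigroups_finite f)]
  have hcard : (Finset.Icc 1 (f + 1)).card = f + 1 := by simp
  conv_rhs => rw [← hcard]
  refine card_le_mul_card_image_of_maps_to (f := multiplicity) ?_ K ?_
  · intro Λ hΛ
    obtain ⟨-, -, hF⟩ := (Set.Finite.mem_toFinset _).1 hΛ
    obtain ⟨-, hf⟩ := frobeniusNumber_coe_iff.1 hF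
    have := (multiplicity_spec hf).2
    have := multiplicity_le (hf (f + 1) (by omega)) (by omega)
    exact Finset.mem_Icc.2 ⟨by omega, by omega⟩
  · intro m hm
    obtain ⟨hm1, hmf⟩ := Finset.mem_Icc.1 hm
    refine le_trans ?_ (hK m hm1 hmf)
    rw [← Set.ncard_coe_finset]
    have hfin : (GapSets.family m (f - m)).Finite :=
      ((range (f - m + 1)).powerset.finite_toSet).subset fun G hG =>
        mem_coe.2 (mem_powerset.2 hG.1)
    refine Set.ncard_le_ncard_of_injOn
      (fun Λ => (range (f - m + 1)).filter (fun x => x + m ∉ Λ)) ?_ ?_ hfin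
    · intro Λ hΛ
      simp only [coe_filter, Set.Finite.mem_toFinset, Set.mem_ofPred_eq] at hΛ
      obtain ⟨⟨-, hmed, hF⟩, rfl⟩ := hΛ
      obtain ⟨-, hf⟩ := frobeniusNumber_coe_iff.1 hF
      obtain ⟨hmem, hm0⟩ := multiplicity_spec hf
      have hnot : ∀ x, x ∉ (range (f - multiplicity Λ + 1)).filter
          (fun x => x + multiplicity Λ ∉ Λ) → x + multiplicity Λ ∈ Λ := by
        intro x hx
        by_cases hlt : x < f - multiplicity Λ + 1
        · simpa [hlt] using hx
        · exact hf _ (by omega)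
      refine ⟨filter_subset _ _, ?_, ?_⟩
      · simp [Λ.add_mem hmem hmem]
      · intro x hx y hy hxy
        refine (mem_filter.1 hxy).2 ?_
        have := add_sub_multiplicity_mem hf hmed (hnot x hx) (hnot y hy) (by omega) (by omega)
        convert this using 1
        omega
    · have key : ∀ Λ ∈ medSemigroups f, multiplicity Λ = m → ∀ x,
          x ∈ Λ ↔ x = 0 ∨ (m ≤ x ∧ x - m ∉ (range (f - m + 1)).filter (fun x => x + m ∉ Λ)) := by
        rintro Λ ⟨-, -, hF⟩ rfl x
        obtain ⟨-, hf⟩ := frobeniusNumber_coe_iff.1 hF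
        by_cases hx0 : x = 0
        · simp [hx0]
        constructor
        · intro hx
          have hle := multiplicity_le hx hx0
          refine Or.inr ⟨hle, fun h => (mem_filter.1 h).2 ?_⟩
          rwa [Nat.sub_add_cancel hle]
        · rintro (h | ⟨hle, h⟩)
          · exact absurd h hx0
          · by_cases hlt : x - multiplicity Λ < f - multiplicity Λ + 1
            · simpa [hlt, Nat.sub_add_cancel hle] using h
            · exact hf _ (by omega)
      intro Λ hΛ Λ' hΛ' h
      simp only [coe_filter, Set.Finite.mem_toFinset, Set.mem_ofPred_eq] at hΛ hΛ' h
      ext x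
      rw [key Λ hΛ.1 hΛ.2, key Λ' hΛ'.1 hΛ'.2, h]

/-! ### Lower bound construction -/

/-- The numerical semigroup `{0, m, 2m} ∪ B ∪ (f, ∞)`. -/
def ofMiddle (m f : ℕ) (B : Finset ℕ) (hf : f < 3 * m) (hB : B ⊆ Finset.Ioo (2 * m) f) :
    AddSubmonoid ℕ where
  carrier := {x | x = 0 ∨ x = m ∨ x = 2 * m ∨ x ∈ B ∨ f < x}
  zero_mem' := Or.inl rfl
  add_mem' := by
    have hB' : ∀ x ∈ B, 2 * m < x := fun x hx => (Finset.mem_Ioo.1 (hB hx)).1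
    rintro x y (rfl | rfl | rfl | hx | hx) (rfl | rfl | rfl | hy | hy) <;>
      simp only [Set.mem_ofPred_eq, zero_add, add_zero] <;>
      first
        | tauto
        | (right; right; left; omega)
        | (try have := hB' _ hx
           try have := hB' _ hy
           right; right; right; right; omega)

theorem mem_ofMiddle {m f : ℕ} {B : Finset ℕ} {hf : f < 3 * m}
    {hB : B ⊆ Finset.Ioo (2 * m) f} {x : ℕ} :
    x ∈ ofMiddle m f B hf hB ↔ x = 0 ∨ x = m ∨ x = 2 * m ∨ x ∈ B ∨ f < x := Iff.rfl

theorem ofMiddle_mem_medSemigroups {m f : ℕ} {B : Finset ℕ} (hf : f < 3 * m)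
    (hB : B ⊆ Finset.Ioo (2 * m) f) (hf0 : f ≠ 0) (hfm : f ≠ m) (hf2m : f ≠ 2 * m)
    (hmf : m ≤ f + 1) : ofMiddle m f B hf hB ∈ medSemigroups f := by
  have hB' : ∀ x ∈ B, 2 * m < x := fun x hx => (Finset.mem_Ioo.1 (hB hx)).1
  have hlarge : ∀ k > f, k ∈ ofMiddle m f B hf hB := fun k hk => by
    rw [mem_ofMiddle]; tauto
  have hge : ∀ x ∈ ofMiddle m f B hf hB, x ≠ 0 → m ≤ x := by
    intro x hx h0
    rcases mem_ofMiddle.1 hx with h | h | h | h | h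
    · exact absurd h h0
    · omega
    · omega
    · have := hB' x h; omega
    · omega
  have hmul : multiplicity (ofMiddle m f B hf hB) = m := by
    obtain ⟨h1, h2⟩ := multiplicity_spec hlarge
    exact le_antisymm (multiplicity_le (mem_ofMiddle.2 (Or.inr (Or.inl rfl))) (by omega))
      (hge _ h1 h2)
  refine ⟨?_, hasMaxEmbDim_of_add_sub_mem hlarge ?_, frobeniusNumber_coe_iff.2 ⟨?_, hlarge⟩⟩
  · refine (Set.finite_Iic f).subset fun x hx => ?_
    by_contra h
    exact hx (hlarge x (by simpa using h))
  · rw [hmul]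
    have hpart : ∀ x ∈ ofMiddle m f B hf hB, x ≠ 0 → x = m ∨ 2 * m ≤ x ∨ f < x := by
      intro x hx h0
      rcases mem_ofMiddle.1 hx with h | h | h | h | h
      · exact absurd h h0
      · omega
      · omega
      · have := hB' x h; omega
      · omega
    intro x hx y hy hx0 hy0
    have hx1 := hge x hx hx0
    have hy1 := hge y hy hy0
    by_cases hxm : x = m
    · rw [hxm, Nat.add_sub_cancel_left]; exact hy
    by_cases hym : y = m
    · rw [hym, Nat.add_sub_cancel]; exact hx
    by_cases hbig : f < x + y - m
    · exact hlarge _ hbig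
    -- With `x, y ≠ m`, either both are at least `2m`, so `x + y - m ≥ 3m > f`, or one exceeds `f`
    -- and the other is at least `m`.
    · have hx2 := hpart x hx hx0
      have hy2 := hpart y hy hy0
      omega
  · rw [mem_ofMiddle]
    rintro (h | h | h | h | h)
    · exact hf0 h
    · exact hfm h
    · exact hf2m h
    · simpa using hB h
    · exact lt_irrefl f h

theorem two_pow_le_MED {m f : ℕ} (hf : f < 3 * m) (hf0 : f ≠ 0) (hfm : f ≠ m)
    (hf2m : f ≠ 2 * m) (hmf : m ≤ f + 1) : 2 ^ (f - 2 * m - 1) ≤ MED f := by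
  classical
  have hcard : (Finset.Ioo (2 * m) f).powerset.card = 2 ^ (f - 2 * m - 1) := by simp
  rw [← hcard, ← Set.ncard_coe_finset, MED]
  refine Set.ncard_le_ncard_of_injOn
    (fun B => if hB : B ⊆ Finset.Ioo (2 * m) f then ofMiddle m f B hf hB else ⊥) ?_ ?_
    (medSemigroups_finite f)
  · intro B hB
    have hB : B ⊆ Finset.Ioo (2 * m) f := Finset.mem_powerset.1 (Finset.mem_coe.1 hB)
    simp only [hB, dif_pos]
    exact ofMiddle_mem_medSemigroups hf hB hf0 hfm hf2m hmf
  · have key : ∀ B (hB : B ⊆ Finset.Ioo (2 * m) f) (x : ℕ),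
        x ∈ B ↔ x ∈ Finset.Ioo (2 * m) f ∧ x ∈ ofMiddle m f B hf hB := by
      intro B hB x
      rw [mem_ofMiddle]
      constructor
      · exact fun h => ⟨hB h, by tauto⟩
      · rintro ⟨h1, h2⟩
        rw [Finset.mem_Ioo] at h1
        rcases h2 with h | h | h | h | h
        · omega
        · omega
        · omega
        · exact h
        · omega
    intro B hB B' hB' h
    have hB : B ⊆ Finset.Ioo (2 * m) f := Finset.mem_powerset.1 (Finset.mem_coe.1 hB)
    have hB' : B' ⊆ Finset.Ioo (2 * m) f := Finset.mem_powerset.1 (Finset.mem_coe.1 hB')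
    simp only [hB, hB', dif_pos] at h
    ext x
    rw [key B hB, key B' hB', h]

end NumSemigroup

/-! ### Asymptotics -/

namespace NumSemigroup

open Filter Topology

theorem MED_pos {f : ℕ} (hf : 1 ≤ f) : 0 < MED f :=
  lt_of_lt_of_le (by positivity)
    (two_pow_le_MED (m := f + 1) (f := f) (by omega) (by omega) (by omega) (by omega) le_rfl)

theorem div_three_sub_le_logb_MED {f : ℕ} (hf : 7 ≤ f) :
    (f : ℝ) / 3 - 3 ≤ Real.logb 2 (MED f) := by
  -- The least `m` with `f < 3m`; the bound `7 ≤ f` ensures `f ≠ 2m`.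
  have h := two_pow_le_MED (m := f / 3 + 1) (f := f) (by omega) (by omega) (by omega) (by omega)
    (by omega)
  have h' : (2 : ℝ) ^ (f - 2 * (f / 3 + 1) - 1) ≤ MED f := by exact_mod_cast h
  have h1 := Real.logb_le_logb_of_le (b := 2) (by norm_num) (by positivity) h'
  rw [Real.logb_pow, Real.logb_self_eq_one (by norm_num), mul_one] at h1
  refine le_trans ?_ h1
  have h2 : f ≤ 3 * (f - 2 * (f / 3 + 1) - 1) + 9 := by omega
  have h3 : (f : ℝ) ≤ 3 * ((f - 2 * (f / 3 + 1) - 1 : ℕ) : ℝ) + 9 := by exact_mod_cast h2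
  linarith

/-- The exponential growth rate in the upper bound with parameter `q`. -/
noncomputable def rate (q : ℕ) : ℝ :=
  2 * Real.logb 2 (1 + 1 / (q : ℝ)) + Real.logb 2 q / q + 1 / 3 + 1 / (3 * q)

theorem logb_MED_le (q : ℕ) (hq : 1 ≤ q) {f : ℕ} (hf : 1 ≤ f) :
    Real.logb 2 (MED f) ≤ Real.logb 2 ((f + 1 : ℕ) : ℝ) +
      ((q * q : ℕ) * Real.logb 2 q + 3) + rate q * ((f + 1 : ℕ) : ℝ) := by
  set n := f + 1 with hn
  have hq0 : (0 : ℝ) < q := by exact_mod_cast hq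
  set c : ℝ := 1 + 1 / (q : ℝ) with hc
  have hc0 : 0 < c := by positivity
  set A := (GapSets.smallSubsets n (q * q)).card
  set A' := (GapSets.smallSubsets n (n / q)).card
  -- Rounded up so that `3k ≥ n + 1 + n / q`; thus `2 ^ k` dominates the cube root.
  set k := (n + 1 + n / q) / 3 + 1 with hk
  have hP : ∀ a : ℕ, a ^ 3 ≤ 2 ^ (n + 1 + n / q) → a ≤ 2 ^ k := by
    intro a ha
    refine le_of_pow_le_pow_left₀ (n := 3) (by norm_num) (by positivity) (ha.trans ?_)
    rw [← pow_mul]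
    exact Nat.pow_le_pow_right (by norm_num) (by omega)
  have h1 : MED f ≤ A * (1 + A' * 2 ^ k) * n :=
    MED_le f _ fun m hm hmf => GapSets.ncard_family_le m (f - m) q n (2 ^ k) hm hq (by omega) hP
  have hA' : 1 ≤ A' := Finset.card_pos.2 ⟨∅, by simp [GapSets.smallSubsets]⟩
  have h2 : MED f ≤ A * (2 * (A' * 2 ^ k)) * n := by
    refine h1.trans ?_
    gcongr
    have : 1 * 1 ≤ A' * 2 ^ k := Nat.mul_le_mul hA' Nat.one_le_two_pow
    omega
  have hA1 : (A : ℝ) ≤ (q : ℝ) ^ (q * q) * c ^ n := by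
    simpa [A, GapSets.smallSubsets, hc] using card_filter_card_le_le (Finset.range n) (q * q) q hq
  have hA2 : (A' : ℝ) ≤ (q : ℝ) ^ (n / q) * c ^ n := by
    simpa [A', GapSets.smallSubsets, hc] using card_filter_card_le_le (Finset.range n) (n / q) q hq
  have h3 : (MED f : ℝ) ≤ (q : ℝ) ^ (q * q) * c ^ n * (2 * ((q : ℝ) ^ (n / q) * c ^ n * 2 ^ k)) * n :=
    calc (MED f : ℝ) ≤ A * (2 * (A' * 2 ^ k)) * n := by exact_mod_cast h2
      _ ≤ _ := by gcongr
  have hn0 : (n : ℝ) ≠ 0 := by positivity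
  have h4 := Real.logb_le_logb_of_le (b := 2) (by norm_num)
    (by exact_mod_cast MED_pos hf) h3
  rw [Real.logb_mul (by positivity) hn0, Real.logb_mul (by positivity) (by positivity),
    Real.logb_mul (by positivity) (by positivity), Real.logb_mul (by positivity) (by positivity),
    Real.logb_mul (by positivity) (by positivity), Real.logb_mul (by positivity) (by positivity),
    Real.logb_pow, Real.logb_pow, Real.logb_pow, Real.logb_pow,
    Real.logb_self_eq_one (by norm_num)] at h4
  have h5 : ((n / q : ℕ) : ℝ) ≤ n / q := Nat.cast_div_le
  have hlq : 0 ≤ Real.logb 2 q := Real.logb_nonneg (by norm_num) (by exact_mod_cast hq)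
  have h6 : ((n / q : ℕ) : ℝ) * Real.logb 2 q ≤ n / q * Real.logb 2 q := by gcongr
  have h7 : (k : ℝ) ≤ (n + 1 + n / q) / 3 + 1 := by
    have : 3 * k ≤ n + 1 + n / q + 3 := by omega
    have : 3 * (k : ℝ) ≤ n + 1 + (n / q : ℕ) + 3 := by exact_mod_cast this
    linarith
  have h8 : rate q * (n : ℝ) = 2 * (n * Real.logb 2 c) + n / q * Real.logb 2 q + n / 3 +
      n / q / 3 := by
    rw [rate, ← hc]; field_simp
  rw [h8]
  linarith

theorem tendsto_logb_natCast_div : Tendsto (fun q : ℕ => Real.logb 2 q / q) atTop (𝓝 0) := by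
  have h := (Real.isLittleO_log_id_atTop.tendsto_div_nhds_zero.comp
    tendsto_natCast_atTop_atTop).div_const (Real.log 2)
  simpa [Function.comp_def, Real.logb, div_right_comm] using h

theorem tendsto_rate : Tendsto rate atTop (𝓝 (1 / 3)) := by
  have h1 : Tendsto (fun q : ℕ => 1 / (q : ℝ)) atTop (𝓝 0) := tendsto_one_div_atTop_nhds_zero_nat
  have h2 : Tendsto (fun q : ℕ => Real.logb 2 (1 + 1 / (q : ℝ))) atTop (𝓝 0) := by
    have : Tendsto (fun x : ℝ => Real.logb 2 (1 + x)) (𝓝 0) (𝓝 (Real.logb 2 (1 + 0))) := by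
      refine Tendsto.div_const ?_ _
      exact (Real.continuousAt_log (by norm_num)).tendsto.comp (tendsto_const_nhds.add tendsto_id)
    simpa [Function.comp_def] using this.comp h1
  have h := (((h2.const_mul 2).add tendsto_logb_natCast_div).add_const (1 / 3 : ℝ)).add (h1.const_mul (1 / 3))
  simp only [mul_zero, zero_add, add_zero] at h
  refine h.congr fun q => ?_
  rw [rate]
  congr 1
  rw [one_div_mul_one_div]

theorem tendsto_logb_MED_div :
    Tendsto (fun f : ℕ => Real.logb 2 (MED f : ℝ) / (f : ℝ)) atTop (𝓝 (1 / 3 : ℝ)) := by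
  have hone : Tendsto (fun f : ℕ => 1 / (f : ℝ)) atTop (𝓝 0) :=
    tendsto_one_div_atTop_nhds_zero_nat
  rw [tendsto_order]
  constructor
  · intro a ha
    have h : Tendsto (fun f : ℕ => (1 / 3 : ℝ) - 3 * (1 / (f : ℝ))) atTop (𝓝 (1 / 3)) := by
      simpa using (hone.const_mul 3).const_sub (1 / 3 : ℝ)
    filter_upwards [h.eventually_const_lt ha, eventually_ge_atTop 7] with f h1 h2
    refine h1.trans_le ?_
    have hf0 : (0 : ℝ) < f := by positivity
    rw [le_div_iff₀ hf0]
    refine le_trans (le_of_eq ?_) (div_three_sub_le_logb_MED h2)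
    field_simp
  · intro a ha
    -- The parameter `q` is fixed before `f` tends to infinity.
    obtain ⟨q, hqa, hq⟩ := ((tendsto_rate.eventually_lt_const ha).and
      (eventually_ge_atTop 1)).exists
    set K : ℝ := (q * q : ℕ) * Real.logb 2 q + 3
    have hshift : Tendsto (fun f : ℕ => f + 1) atTop atTop := tendsto_add_atTop_nat 1
    have h1 : Tendsto (fun f : ℕ => Real.logb 2 ((f + 1 : ℕ) : ℝ) / ((f + 1 : ℕ) : ℝ) +
        K * (1 / ((f + 1 : ℕ) : ℝ)) + rate q) atTop (𝓝 (rate q)) := by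
      simpa [Function.comp_def] using
        ((tendsto_logb_natCast_div.comp hshift).add ((hone.comp hshift).const_mul K)).add_const (rate q)
    -- The factor `(f + 1) / f` converts division by `f + 1` into division by `f`.
    have h2 : Tendsto (fun f : ℕ => 1 + 1 / (f : ℝ)) atTop (𝓝 1) := by
      simpa using hone.const_add 1
    have h3 := h1.mul h2
    rw [mul_one] at h3
    filter_upwards [h3.eventually_lt_const hqa, eventually_ge_atTop 1] with f hlt hf
    refine lt_of_le_of_lt ?_ hlt
    have hf0 : (0 : ℝ) < f := by positivity
    rw [div_le_iff₀ hf0]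
    refine (logb_MED_le q hq hf).trans (le_of_eq ?_)
    simp only [K]
    push_cast
    field_simp

end NumSemigroup

theorem mainTheorem5 :
    (∃ ε : ℕ → ℝ, Asymptotics.IsLittleO Filter.atTop ε (fun f : ℕ => (f : ℝ)) ∧
      ∀ f : ℕ, 1 ≤ f → (NumSemigroup.MED f : ℝ) = (2 : ℝ) ^ ((f : ℝ) / 3 + ε f)) ∧
    Filter.Tendsto (fun f : ℕ => Real.logb 2 (NumSemigroup.MED f : ℝ) / (f : ℝ))
      Filter.atTop (nhds (1 / 3 : ℝ)) := by
  refine ⟨⟨fun f => Real.logb 2 (NumSemigroup.MED f) - (f : ℝ) / 3, ?_, fun f hf => ?_⟩,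
    NumSemigroup.tendsto_logb_MED_div⟩
  · rw [Asymptotics.isLittleO_iff_tendsto']
    · have h := NumSemigroup.tendsto_logb_MED_div.sub_const (1 / 3 : ℝ)
      rw [sub_self] at h
      refine h.congr' ?_
      filter_upwards [Filter.eventually_ge_atTop 1] with f hf
      have hf0 : (f : ℝ) ≠ 0 := by positivity
      field_simp
    · filter_upwards [Filter.eventually_ge_atTop 1] with f hf h0
      have : f = 0 := by exact_mod_cast h0
      omega
  · rw [add_sub_cancel, Real.rpow_logb (by norm_num) (by norm_num)
      (by exact_mod_cast NumSemigroup.MED_pos hf)]
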